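/- Let $Z, Z_1, Z_2, \ldots$ be i.i.d. random vectors in $\mathbb{R}^2$, let $S_0 := 0$ and $S_n := \sum_{k=1}^n Z_k$ for $n \geq 1$, and let $D_n := \operatorname{diam}\{S_0, S_1, \ldots, S_n\}$ (which equals the diameter of the convex hull of $S_0, \ldots, S_n$), with respect to the Euclidean norm $\|\cdot\|$. Suppose that $\mathbb{E}(\|Z\|^2) < \infty$ and that $\mu := \mathbb{E} Z \neq 0$. Put $\hat\mu := \mu/\|\mu\|$ and $\sigma^2_\mu := \mathbb{E}\big[((Z-\mu)\cdot\hat\mu)^2\big]$. Then $D_n$ is square-integrable for every $n$, and \[ \lim_{n\to\infty} n^{-1} \operatorname{Var} D_n = \sigma^2_\mu . \] Moreover, if $\sigma^2_\mu > 0$, then for $\zeta \sim \mathcal{N}(0,1)$, as $n \to \infty$, \[ \frac{D_n - \mathbb{E} D_n}{\sqrt{\operatorname{Var} D_n}} \to \zeta \quad\text{and}\quad \frac{D_n - n\|\mu\|}{\sqrt{n\,\sigma^2_\mu}} \to \zeta \] in distribution. -/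

import Mathlib

namespace PlanarWalk

/-- The Euclidean plane. -/
abbrev Plane : Type := EuclideanSpace ℝ (Fin 2)

/-- The random walk `S_n = Z_1 + ⋯ + Z_n` (so `S_0 = 0`); the step `Z_{k+1}` is `X k`. -/
noncomputable def walk {Ω : Type*} (X : ℕ → Ω → Plane) (n : ℕ) (ω : Ω) : Plane :=
  ∑ k ∈ Finset.range n, X k ω

/-- The diameter `D_n` of the set `{S_0, S_1, …, S_n}`. -/
noncomputable def diameter {Ω : Type*} (X : ℕ → Ω → Plane) (n : ℕ) (ω : Ω) : ℝ :=
  Metric.diam ((fun k : ℕ => walk X k ω) '' Set.Iic n)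

/-- `D_n` is also the diameter of the convex hull of `S_0, S_1, …, S_n`. -/
theorem diameter_eq_diam_convexHull {Ω : Type*} (X : ℕ → Ω → Plane) (n : ℕ) (ω : Ω) :
    diameter X n ω =
      Metric.diam (convexHull ℝ ((fun k : ℕ => walk X k ω) '' Set.Iic n)) :=
  (convexHull_diam _).symm

/-- The mean vector `μ = E Z`. -/
noncomputable def drift {Ω : Type*} [MeasurableSpace Ω] (P : MeasureTheory.Measure Ω)
    (Z : Ω → Plane) : Plane :=
  ∫ ω, Z ω ∂P

/-- `σ²_μ = E [((Z - μ) · μ̂)²]`, where `μ̂ = μ / ‖μ‖`. -/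
noncomputable def sigmaParSq {Ω : Type*} [MeasurableSpace Ω] (P : MeasureTheory.Measure Ω)
    (Z : Ω → Plane) : ℝ :=
  ∫ ω, (inner ℝ (Z ω - drift P Z) (‖drift P Z‖⁻¹ • drift P Z)) ^ 2 ∂P

end PlanarWalk

open MeasureTheory ProbabilityTheory Filter Topology

namespace PlanarWalk

/-! Write `D_n = S_n · μ̂ + T_n` with `T_n ≥ 0`. The first term is a sum of i.i.d. real variables
with mean `n‖μ‖` and variance exactly `n σ²_μ`, and it obeys the classical CLT. Everything therefore
reduces to `E T_n² = o(n)`, which is `tendsto_integral_sq_excess`. Given this, Cauchy–Schwarz makes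
the covariance of the two terms negligible, the mean of `D_n` is `n‖μ‖ + o(√n)`, and Slutsky's
theorem carries the CLT over to `D_n`.

Why `T_n` is small: along the drift, a walk can undershoot its start or overshoot its end only
within time `hn` of that endpoint, where Doob's inequality bounds the effect by `O(hn)` in mean
square, or else against a drift of order `hn`, where a fluctuation `B` leaves at most `B²/(hmn)`
(`abs_increment_le`). Across the drift, a fluctuation `B` lengthens a segment of length of order `n`
by only `O(B²/n)` (`sqrt_sq_add_sq_le`).

Two moments of the steps do not control `E B⁴`. Truncation (`exists_max_decomposition`) splits the
fluctuations as `A + B` with `E A² ≤ δn` and `E B⁴ ≤ Cn²`; `A` enters linearly and `B`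
quadratically, so `E T_n² ≤ εn + K` for every `ε`. -/

/-- Pathwise form of Doob's `L²` maximal inequality. -/
theorem sq_partialSups_le (x : ℕ → ℝ) (n : ℕ) :
    (partialSups x n) ^ 2 ≤
      4 * x n ^ 2 - 4 * ∑ i ∈ Finset.range n, partialSups x i * (x (i + 1) - x i) := by
  -- The slack is constant until a new record is set, and then grows by half the squared overshoot.
  have key : (partialSups x n) ^ 2 / 2 ≤ partialSups x n * x n -
      ∑ i ∈ Finset.range n, partialSups x i * (x (i + 1) - x i) := by
    induction n with
    | zero => simp; nlinarith [sq_nonneg (x 0)]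
    | succ n ih =>
      rw [Finset.sum_range_succ, partialSups_add_one]
      rcases le_total (x (n + 1)) (partialSups x n) with h | h
      · rw [sup_eq_left.2 h]; nlinarith
      · rw [sup_eq_right.2 h]; nlinarith [sq_nonneg (x (n + 1) - partialSups x n)]
  nlinarith [sq_nonneg (partialSups x n - 2 * x n)]

theorem sq_partialSups_abs (f : ℕ → ℝ) (n : ℕ) :
    (partialSups (fun k => |f k|) n) ^ 2 = partialSups (fun k => f k ^ 2) n := by
  refine le_antisymm ?_ (partialSups_le _ _ _ fun k hk => ?_)
  · obtain ⟨k, hk, h⟩ := exists_partialSups_eq (fun k => |f k|) n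
    rw [h, sq_abs]
    exact le_partialSups_of_le (fun k => f k ^ 2) hk
  · rw [← sq_abs]
    exact pow_le_pow_left₀ (abs_nonneg _) (le_partialSups_of_le (fun k => |f k|) hk) 2

/-! ### Maximal inequalities in `L²` and `L⁴`, and truncation. -/

section Maximal

variable {Ω : Type*} [MeasurableSpace Ω] {P : Measure Ω}

theorem memLp_partialSups {x : ℕ → Ω → ℝ} {p : ENNReal} (hx : ∀ k, MemLp (x k) p P) (n : ℕ) :
    MemLp (fun ω => partialSups (fun k => x k ω) n) p P := by
  induction n with
  | zero => simpa using hx 0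
  | succ n ih =>
    simp only [partialSups_add_one]
    exact ih.sup (hx (n + 1))

/-- Only the consequence of the submartingale property that the pathwise bound uses is assumed:
increments tested against the running maximum. -/
theorem integral_sq_partialSups_le {x : ℕ → Ω → ℝ} (hx : ∀ k, MemLp (x k) 2 P)
    (hsub : ∀ i, 0 ≤ ∫ ω, partialSups (fun k => x k ω) i * (x (i + 1) ω - x i ω) ∂P) (n : ℕ) :
    ∫ ω, (partialSups (fun k => x k ω) n) ^ 2 ∂P ≤ 4 * ∫ ω, x n ω ^ 2 ∂P := by
  have hint : ∀ i, Integrable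
      (fun ω => partialSups (fun k => x k ω) i * (x (i + 1) ω - x i ω)) P := fun i =>
    (memLp_partialSups hx i).integrable_mul ((hx (i + 1)).sub (hx i))
  have h1 : Integrable (fun ω => 4 * x n ω ^ 2) P := (hx n).integrable_sq.const_mul 4
  have h2 : Integrable (fun ω => 4 * ∑ i ∈ Finset.range n,
      partialSups (fun k => x k ω) i * (x (i + 1) ω - x i ω)) P :=
    (integrable_finsetSum _ fun i _ => hint i).const_mul 4
  calc ∫ ω, (partialSups (fun k => x k ω) n) ^ 2 ∂P
      ≤ ∫ ω, (4 * x n ω ^ 2 - 4 * ∑ i ∈ Finset.range n,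
          partialSups (fun k => x k ω) i * (x (i + 1) ω - x i ω)) ∂P :=
        integral_mono (memLp_partialSups hx n).integrable_sq (h1.sub h2)
          fun ω => sq_partialSups_le (fun k => x k ω) n
    _ = 4 * ∫ ω, x n ω ^ 2 ∂P - 4 * ∑ i ∈ Finset.range n,
          ∫ ω, partialSups (fun k => x k ω) i * (x (i + 1) ω - x i ω) ∂P := by
        rw [integral_sub h1 h2, integral_const_mul, integral_const_mul,
          integral_finsetSum _ fun i _ => hint i]
    _ ≤ 4 * ∫ ω, x n ω ^ 2 ∂P := by
        have := Finset.sum_nonneg fun i (_ : i ∈ Finset.range n) => hsub i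
        linarith

/-- A function of the first `i` steps is uncorrelated with the centred step `ξ i`. -/
theorem integral_past_mul_eq_zero {ξ : ℕ → Ω → ℝ} (hindep : iIndepFun ξ P)
    (hm : ∀ k, AEMeasurable (ξ k) P) (i : ℕ) (h0 : ∫ ω, ξ i ω ∂P = 0)
    (Φ : (ℕ → ℝ) → ℝ) (hΦ : Measurable Φ) :
    ∫ ω, Φ (fun k => if k < i then ξ k ω else 0) * ξ i ω ∂P = 0 := by
  have h := hindep.indepFun_finset₀ (Finset.range i) {i} (by simp) hm
  -- Extension by zero lets `Φ` act on whole sequences; `sum_past` later removes the cut-off.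
  let e : (Finset.range i → ℝ) → (ℕ → ℝ) := fun v k => if hk : k < i then v ⟨k, by simpa⟩ else 0
  have he : Measurable e := by
    refine measurable_pi_lambda _ fun k => ?_
    by_cases hk : k < i
    · simpa [e, hk] using measurable_pi_apply _
    · simp [e, hk]
  have hψ : Measurable fun v : ({i} : Finset ℕ) → ℝ => v ⟨i, by simp⟩ := measurable_pi_apply _
  have h' := h.comp (φ := fun v => Φ (e v)) (ψ := fun v : ({i} : Finset ℕ) → ℝ => v ⟨i, by simp⟩)
    (hΦ.comp he) hψ
  have hpast : (fun ω => Φ (fun k => if k < i then ξ k ω else 0)) =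
      (fun v => Φ (e v)) ∘ fun ω (k : Finset.range i) => ξ k ω := by
    funext ω
    simp only [Function.comp, e]
    congr 1
  have hmp : AEMeasurable (fun ω => Φ (fun k => if k < i then ξ k ω else 0)) P := by
    refine hΦ.comp_aemeasurable (aemeasurable_pi_lambda _ fun k => ?_)
    by_cases hk : k < i
    · simpa [hk] using hm k
    · simp [hk]
  have hI : IndepFun (fun ω => Φ (fun k => if k < i then ξ k ω else 0)) (ξ i) P := by
    rw [hpast]; exact h'
  rw [hI.integral_fun_mul_eq_mul_integral hmp.aestronglyMeasurable (hm i).aestronglyMeasurable,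
    h0, mul_zero]

theorem sum_past (ξ : ℕ → ℝ) {i j : ℕ} (h : j ≤ i) :
    (∑ k ∈ Finset.range j, if k < i then ξ k else 0) = ∑ k ∈ Finset.range j, ξ k :=
  Finset.sum_congr rfl fun _ hk => if_pos ((Finset.mem_range.1 hk).trans_le h)

theorem measurable_partialSups {α : Type*} [MeasurableSpace α] {x : ℕ → α → ℝ}
    (hx : ∀ k, Measurable (x k)) (n : ℕ) : Measurable fun a => partialSups (fun k => x k a) n := by
  induction n with
  | zero => simpa using hx 0
  | succ n ih =>
    simp only [partialSups_add_one]
    exact ih.sup (hx (n + 1))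

theorem partialSups_congr_of_le {f g : ℕ → ℝ} {n : ℕ} (h : ∀ k ≤ n, f k = g k) :
    partialSups f n = partialSups g n :=
  le_antisymm (partialSups_le _ _ _ fun k hk => (h k hk).trans_le (le_partialSups_of_le g hk))
    (partialSups_le _ _ _ fun k hk => (h k hk).symm.trans_le (le_partialSups_of_le f hk))

variable {ξ : ℕ → Ω → ℝ}

theorem memLp_sum_range {p : ENNReal} (hL : ∀ k, MemLp (ξ k) p P) (n : ℕ) :
    MemLp (fun ω => ∑ k ∈ Finset.range n, ξ k ω) p P :=
  memLp_finsetSum _ fun k _ => hL k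

theorem integral_sq_sum_le [IsProbabilityMeasure P] (hindep : iIndepFun ξ P)
    (hL : ∀ k, MemLp (ξ k) 2 P) (h0 : ∀ k, ∫ ω, ξ k ω ∂P = 0) {s : ℝ}
    (hs : ∀ k, ∫ ω, ξ k ω ^ 2 ∂P ≤ s) (n : ℕ) :
    ∫ ω, (∑ k ∈ Finset.range n, ξ k ω) ^ 2 ∂P ≤ n * s := by
  induction n with
  | zero => simp
  | succ n ih =>
    have hz := integral_past_mul_eq_zero hindep (fun k => (hL k).aestronglyMeasurable.aemeasurable)
      n (h0 n) (fun v => 2 * ∑ k ∈ Finset.range n, v k) (by fun_prop)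
    simp only [sum_past _ le_rfl] at hz
    have hU := memLp_sum_range hL n
    have e : ∀ ω, (∑ k ∈ Finset.range (n + 1), ξ k ω) ^ 2 = (∑ k ∈ Finset.range n, ξ k ω) ^ 2 +
        (2 * ∑ k ∈ Finset.range n, ξ k ω) * ξ n ω + ξ n ω ^ 2 := fun ω => by
      rw [Finset.sum_range_succ]; ring
    simp only [e]
    have i2 : Integrable (fun ω => (2 * ∑ k ∈ Finset.range n, ξ k ω) * ξ n ω) P :=
      (hU.const_mul 2).integrable_mul (hL n)
    have i1 : Integrable (fun ω => (∑ k ∈ Finset.range n, ξ k ω) ^ 2 +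
        (2 * ∑ k ∈ Finset.range n, ξ k ω) * ξ n ω) P := hU.integrable_sq.add i2
    rw [integral_add i1 (hL n).integrable_sq, integral_add hU.integrable_sq i2, hz]
    push_cast
    linarith [hs n]

/-- Doob's `L²` maximal inequality for sums of independent centred variables. -/
theorem integral_sq_max_abs_sum_le [IsProbabilityMeasure P] (hindep : iIndepFun ξ P)
    (hL : ∀ k, MemLp (ξ k) 2 P) (h0 : ∀ k, ∫ ω, ξ k ω ∂P = 0) {s : ℝ}
    (hs : ∀ k, ∫ ω, ξ k ω ^ 2 ∂P ≤ s) (n : ℕ) :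
    ∫ ω, (partialSups (fun k => |∑ j ∈ Finset.range k, ξ j ω|) n) ^ 2 ∂P ≤ 4 * (n * s) := by
  have hA : ∀ k, MemLp (fun ω => |∑ j ∈ Finset.range k, ξ j ω|) 2 P :=
    fun k => (memLp_sum_range hL k).abs
  refine (integral_sq_partialSups_le hA (fun i => ?_) n).trans ?_
  -- Subgradient bound `|u + ξ| - |u| ≥ sgn(u) ξ`, with `sgn 0 = 1`: the right side is a function of
  -- the past times a centred step.
  · have hz := integral_past_mul_eq_zero hindep (fun k => (hL k).aestronglyMeasurable.aemeasurable)
      i (h0 i) (fun v => partialSups (fun k => |∑ j ∈ Finset.range k, v j|) i *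
        (if 0 ≤ ∑ j ∈ Finset.range i, v j then 1 else -1))
      ((measurable_partialSups (fun k => by fun_prop) i).mul
        (Measurable.ite (measurableSet_le (by fun_prop) (by fun_prop)) (by fun_prop)
          (by fun_prop)))
    rw [← hz]
    have hm := memLp_partialSups hA i
    have e : ∀ ω, partialSups (fun k => |∑ j ∈ Finset.range k, if j < i then ξ j ω else 0|) i =
        partialSups (fun k => |∑ j ∈ Finset.range k, ξ j ω|) i := fun ω =>
      partialSups_congr_of_le fun k hk => by rw [sum_past (fun j => ξ j ω) hk]
    simp only [e, sum_past _ le_rfl]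
    refine integral_mono ?_ (hm.integrable_mul ((hA (i + 1)).sub (hA i))) fun ω => ?_
    · refine MemLp.integrable_mul (hm.of_le (hm.aestronglyMeasurable.mul ?_) (ae_of_all _ ?_))
        (hL i)
      · refine AEMeasurable.aestronglyMeasurable (Measurable.comp_aemeasurable
          (g := fun t : ℝ => if 0 ≤ t then (1 : ℝ) else -1) ?_
          (memLp_sum_range hL i).aestronglyMeasurable.aemeasurable)
        exact Measurable.ite measurableSet_Ici measurable_const measurable_const
      · intro ω
        simp only [norm_mul]
        split_ifs <;> simp
    · have hpos : 0 ≤ partialSups (fun k => |∑ j ∈ Finset.range k, ξ j ω|) i :=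
        (abs_nonneg _).trans (le_partialSups (fun k => |∑ j ∈ Finset.range k, ξ j ω|) i)
      simp only [mul_assoc]
      refine mul_le_mul_of_nonneg_left ?_ hpos
      rw [Finset.sum_range_succ]
      split_ifs with h
      · rw [abs_of_nonneg h]; linarith [le_abs_self (∑ j ∈ Finset.range i, ξ j ω + ξ i ω)]
      · rw [abs_of_neg (not_le.1 h)]
        linarith [neg_le_abs (∑ j ∈ Finset.range i, ξ j ω + ξ i ω)]
  · simp only [sq_abs]
    linarith [integral_sq_sum_le hindep hL h0 hs n]

theorem memLp_pow_sum_of_bound [IsProbabilityMeasure P] (hm : ∀ k, AEMeasurable (ξ k) P) {b : ℝ}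
    (hb : ∀ k ω, |ξ k ω| ≤ b) (n r : ℕ) (p : ENNReal) :
    MemLp (fun ω => (∑ k ∈ Finset.range n, ξ k ω) ^ r) p P := by
  refine MemLp.of_bound ((Finset.aemeasurable_fun_sum _ fun k _ => hm k).pow_const
    r).aestronglyMeasurable ((n * b) ^ r) (ae_of_all _ fun ω => ?_)
  rw [norm_pow, Real.norm_eq_abs]
  refine pow_le_pow_left₀ (abs_nonneg _) ((Finset.abs_sum_le_sum_abs _ _).trans ?_) r
  refine (Finset.sum_le_sum fun k _ => hb k ω).trans ?_
  simp

/-- On expanding `(u + ξ)⁴`, the term `4u³ξ` has mean zero and the rest is at most `8b²u² + 3b⁴`.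
Since `E u² ≤ nb²`, each step adds at most `4b⁴(2n + 1)`. -/
theorem integral_pow_four_sum_le [IsProbabilityMeasure P] (hindep : iIndepFun ξ P)
    (hm : ∀ k, AEMeasurable (ξ k) P) (h0 : ∀ k, ∫ ω, ξ k ω ∂P = 0) {b : ℝ}
    (hb : ∀ k ω, |ξ k ω| ≤ b) (n : ℕ) :
    ∫ ω, (∑ k ∈ Finset.range n, ξ k ω) ^ 4 ∂P ≤ 4 * b ^ 4 * n ^ 2 := by
  have hL : ∀ k (p : ENNReal), MemLp (ξ k) p P := fun k p =>
    MemLp.of_bound (hm k).aestronglyMeasurable b (ae_of_all _ fun ω => hb k ω)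
  have hsq : ∀ k ω, ξ k ω ^ 2 ≤ b ^ 2 := fun k ω => by
    rw [← sq_abs]; exact pow_le_pow_left₀ (abs_nonneg _) (hb k ω) 2
  have hs : ∀ k, ∫ ω, ξ k ω ^ 2 ∂P ≤ b ^ 2 := fun k =>
    (integral_mono (hL k 2).integrable_sq (integrable_const _) (hsq k)).trans (by simp)
  induction n with
  | zero => simp
  | succ n ih =>
    have hz := integral_past_mul_eq_zero hindep hm n (h0 n)
      (fun v => 4 * (∑ k ∈ Finset.range n, v k) ^ 3) (by fun_prop)
    simp only [sum_past _ le_rfl] at hz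
    have i4 := (memLp_pow_sum_of_bound hm hb n 4 1).integrable le_rfl
    have i2 : Integrable (fun ω => 8 * b ^ 2 * (∑ k ∈ Finset.range n, ξ k ω) ^ 2 + 3 * b ^ 4) P :=
      (((memLp_pow_sum_of_bound hm hb n 2 1).integrable le_rfl).const_mul _).add
        (integrable_const _)
    have i3 : Integrable (fun ω => (4 * (∑ k ∈ Finset.range n, ξ k ω) ^ 3) * ξ n ω) P :=
      ((memLp_pow_sum_of_bound hm hb n 3 2).const_mul 4).integrable_mul (hL n 2)
    have i34 : Integrable (fun ω => (∑ k ∈ Finset.range n, ξ k ω) ^ 4 +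
        (4 * (∑ k ∈ Finset.range n, ξ k ω) ^ 3) * ξ n ω) P := i4.add i3
    calc ∫ ω, (∑ k ∈ Finset.range (n + 1), ξ k ω) ^ 4 ∂P
        ≤ ∫ ω, ((∑ k ∈ Finset.range n, ξ k ω) ^ 4 +
            (4 * (∑ k ∈ Finset.range n, ξ k ω) ^ 3) * ξ n ω +
            (8 * b ^ 2 * (∑ k ∈ Finset.range n, ξ k ω) ^ 2 + 3 * b ^ 4)) ∂P := by
          refine integral_mono ((memLp_pow_sum_of_bound hm hb (n + 1) 4 1).integrable le_rfl)
            (i34.add i2) fun ω => ?_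
          simp only [Finset.sum_range_succ]
          set u := ∑ k ∈ Finset.range n, ξ k ω
          have h1 : u ^ 2 * ξ n ω ^ 2 ≤ u ^ 2 * b ^ 2 :=
            mul_le_mul_of_nonneg_left (hsq n ω) (sq_nonneg u)
          have h2 : ξ n ω ^ 4 ≤ b ^ 4 := by
            nlinarith [hsq n ω, sq_nonneg (ξ n ω), sq_nonneg b]
          -- This square gives `4uξ³ ≤ 2u²ξ² + 2ξ⁴`.
          nlinarith [sq_nonneg (u * ξ n ω - ξ n ω ^ 2)]
      _ = ∫ ω, (∑ k ∈ Finset.range n, ξ k ω) ^ 4 ∂P +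
            (8 * b ^ 2 * ∫ ω, (∑ k ∈ Finset.range n, ξ k ω) ^ 2 ∂P + 3 * b ^ 4) := by
          rw [integral_add i34 i2, integral_add i4 i3, hz, integral_add
            (((memLp_pow_sum_of_bound hm hb n 2 1).integrable le_rfl).const_mul _)
            (integrable_const _), integral_const_mul]
          simp
      _ ≤ 4 * b ^ 4 * (n + 1 : ℕ) ^ 2 := by
          have h2 := mul_le_mul_of_nonneg_left
            (integral_sq_sum_le hindep (fun k => hL k 2) h0 hs n)
            (by positivity : (0 : ℝ) ≤ 8 * b ^ 2)
          push_cast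
          have h3 : (0 : ℝ) ≤ b ^ 4 := by positivity
          nlinarith

/-- Doob's inequality for the submartingale of squared partial sums, whose increments are at least
`2uξ`; `16` is Doob's `4` times the `4` of the fourth-moment bound. -/
theorem integral_sq_max_sq_sum_le [IsProbabilityMeasure P] (hindep : iIndepFun ξ P)
    (hm : ∀ k, AEMeasurable (ξ k) P) (h0 : ∀ k, ∫ ω, ξ k ω ∂P = 0) {b : ℝ}
    (hb : ∀ k ω, |ξ k ω| ≤ b) (n : ℕ) :
    ∫ ω, (partialSups (fun k => (∑ j ∈ Finset.range k, ξ j ω) ^ 2) n) ^ 2 ∂P ≤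
      16 * b ^ 4 * n ^ 2 := by
  have hA : ∀ k, MemLp (fun ω => (∑ j ∈ Finset.range k, ξ j ω) ^ 2) 2 P :=
    fun k => memLp_pow_sum_of_bound hm hb k 2 2
  have hξ : ∀ k, MemLp (fun ω => ξ k ω ^ 2) 2 P := fun k =>
    MemLp.of_bound ((hm k).pow_const 2).aestronglyMeasurable (b ^ 2) (ae_of_all _ fun ω => by
      rw [norm_pow]; exact pow_le_pow_left₀ (norm_nonneg _) (hb k ω) 2)
  refine (integral_sq_partialSups_le hA (fun i => ?_) n).trans ?_
  · have hz := integral_past_mul_eq_zero hindep hm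
      i (h0 i) (fun v => partialSups (fun k => (∑ j ∈ Finset.range k, v j) ^ 2) i *
        (2 * ∑ j ∈ Finset.range i, v j))
      ((measurable_partialSups (fun k => by fun_prop) i).mul (by fun_prop))
    rw [← hz]
    have hmx := memLp_partialSups hA i
    have e : ∀ ω, partialSups (fun k => (∑ j ∈ Finset.range k, if j < i then ξ j ω else 0) ^ 2) i =
        partialSups (fun k => (∑ j ∈ Finset.range k, ξ j ω) ^ 2) i := fun ω =>
      partialSups_congr_of_le fun k hk => by rw [sum_past (fun j => ξ j ω) hk]
    simp only [e, sum_past _ le_rfl]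
    have iR := hmx.integrable_mul ((hA (i + 1)).sub (hA i))
    have iE := hmx.integrable_mul (hξ i)
    refine integral_mono ((iR.sub iE).congr (ae_of_all _ fun ω => ?_)) iR fun ω => ?_
    · simp only [Pi.sub_apply, Pi.mul_apply, Finset.sum_range_succ]
      ring
    · have hpos : 0 ≤ partialSups (fun k => (∑ j ∈ Finset.range k, ξ j ω) ^ 2) i :=
        (sq_nonneg _).trans (le_partialSups (fun k => (∑ j ∈ Finset.range k, ξ j ω) ^ 2) i)
      simp only [mul_assoc]
      refine mul_le_mul_of_nonneg_left ?_ hpos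
      rw [Finset.sum_range_succ]
      nlinarith [sq_nonneg (ξ i ω)]
  · have h4 := integral_pow_four_sum_le hindep hm h0 hb n
    have e : ∀ ω, ((∑ k ∈ Finset.range n, ξ k ω) ^ 2) ^ 2 = (∑ k ∈ Finset.range n, ξ k ω) ^ 4 :=
      fun ω => by ring
    simp only [e]
    linarith

/-- The small-jump/large-jump decomposition: up to a part of small variance, the maximum of a
centred square-integrable walk has bounded normalised fourth moment. -/
theorem exists_max_decomposition [IsProbabilityMeasure P] {ζ : Ω → ℝ} (hindep : iIndepFun ξ P)
    (hident : ∀ k, IdentDistrib (ξ k) ζ P P) (hL : MemLp ζ 2 P) (h0 : ∫ ω, ζ ω ∂P = 0)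
    {δ : ℝ} (hδ : 0 < δ) :
    ∃ C : ℝ, ∃ A B : ℕ → Ω → ℝ, (∀ n ω, 0 ≤ A n ω) ∧ (∀ n ω, 0 ≤ B n ω) ∧
      (∀ n, MemLp (A n) 2 P) ∧ (∀ n, MemLp (fun ω => B n ω ^ 2) 2 P) ∧
      (∀ n ω, ∀ k ≤ n, |∑ j ∈ Finset.range k, ξ j ω| ≤ A n ω + B n ω) ∧
      (∀ n, ∫ ω, A n ω ^ 2 ∂P ≤ δ * n) ∧ (∀ n : ℕ, ∫ ω, (B n ω ^ 2) ^ 2 ∂P ≤ C * n ^ 2) := by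
  let g : ℕ → ℝ → ℝ := fun R x => if |x| ≤ R then x else 0
  have hg : ∀ R, Measurable (g R) := fun R =>
    Measurable.ite (measurableSet_le (by fun_prop) (by fun_prop)) measurable_id measurable_const
  have hgb : ∀ R x, |g R x| ≤ R := fun R x => by
    simp only [g]; split_ifs with h
    · exact h
    · simp
  have hζ := hL.aestronglyMeasurable.aemeasurable
  -- The tail is made smaller than `δ / 4` to absorb the factor `4` in Doob's inequality.
  obtain ⟨R, hR⟩ : ∃ R : ℕ, ∫ ω, (ζ ω - g R (ζ ω)) ^ 2 ∂P < δ / 4 := by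
    have ht : Tendsto (fun R : ℕ => ∫ ω, (ζ ω - g R (ζ ω)) ^ 2 ∂P) atTop
        (𝓝 (∫ _, (0 : ℝ) ∂P)) := by
      refine tendsto_integral_of_dominated_convergence (fun ω => ζ ω ^ 2)
        (fun R => ((hζ.sub ((hg R).comp_aemeasurable hζ)).pow_const 2).aestronglyMeasurable)
        hL.integrable_sq (fun R => ae_of_all _ fun ω => ?_) (ae_of_all _ fun ω => ?_)
      · simp only [g]; split_ifs <;> simp [sq_nonneg]
      · obtain ⟨N, hN⟩ := exists_nat_ge |ζ ω|
        refine tendsto_const_nhds.congr' ?_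
        filter_upwards [eventually_ge_atTop N] with R hR
        have : |ζ ω| ≤ R := hN.trans (by exact_mod_cast hR)
        simp [g, this]
    simp only [integral_zero] at ht
    exact (ht.eventually (gt_mem_nhds (by positivity))).exists
  set c := ∫ ω, g R (ζ ω) ∂P with hc
  have hgi : MemLp (fun ω => g R (ζ ω)) 2 P :=
    MemLp.of_bound ((hg R).comp_aemeasurable hζ).aestronglyMeasurable R
      (ae_of_all _ fun ω => hgb R _)
  -- `p` is the centred truncation, bounded by `2R`; `q` is the remainder, again centred.
  let p : ℝ → ℝ := fun x => g R x - c
  let q : ℝ → ℝ := fun x => x - p x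
  have hp : Measurable p := (hg R).sub_const c
  have hq : Measurable q := measurable_id.sub hp
  have hcR : |c| ≤ R := by
    have := norm_integral_le_of_norm_le_const (μ := P) (f := fun ω => g R (ζ ω)) (C := R)
      (ae_of_all _ fun ω => hgb R _)
    simpa using this
  have hpb : ∀ x, |p x| ≤ 2 * R := fun x => (abs_sub _ _).trans (by linarith [hgb R x])
  have hpL : MemLp (fun ω => p (ζ ω)) 2 P := hgi.sub (memLp_const c)
  have hqL : MemLp (fun ω => q (ζ ω)) 2 P := hL.sub hpL
  have hp0 : ∫ ω, p (ζ ω) ∂P = 0 := by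
    simp only [p]
    rw [integral_sub (hgi.integrable one_le_two) (integrable_const _)]
    simp [hc]
  have hq0 : ∫ ω, q (ζ ω) ∂P = 0 := by
    simp only [q]
    rw [integral_sub (hL.integrable one_le_two) (hpL.integrable one_le_two), h0, hp0, sub_zero]
  -- Recentring only helps: the second moment of the tail drops by `c²`.
  have hq2 : ∫ ω, q (ζ ω) ^ 2 ∂P ≤ δ / 4 := by
    have hd : MemLp (fun ω => ζ ω - g R (ζ ω)) 2 P := hL.sub hgi
    have h1 : ∫ ω, (ζ ω - g R (ζ ω)) ∂P = -c := by
      rw [integral_sub (hL.integrable one_le_two) (hgi.integrable one_le_two), h0, zero_sub]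
    have h2 : ∀ ω, q (ζ ω) ^ 2 = (ζ ω - g R (ζ ω)) ^ 2 + (2 * c * (ζ ω - g R (ζ ω)) + c ^ 2) :=
      fun ω => by simp only [q, p]; ring
    simp only [h2]
    have i1 := (hd.integrable one_le_two).const_mul (2 * c)
    have i2 : Integrable (fun ω => 2 * c * (ζ ω - g R (ζ ω)) + c ^ 2) P :=
      i1.add (integrable_const _)
    rw [integral_add hd.integrable_sq i2,
      integral_add i1 (integrable_const _), integral_const_mul, h1]
    simp only [integral_const, probReal_univ, one_smul]
    nlinarith [sq_nonneg c]
  have hξm : ∀ k, AEMeasurable (ξ k) P := fun k => (hident k).aemeasurable_fst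
  have hindp : iIndepFun (fun k ω => p (ξ k ω)) P := hindep.comp (fun _ => p) fun _ => hp
  have hindq : iIndepFun (fun k ω => q (ξ k ω)) P := hindep.comp (fun _ => q) fun _ => hq
  have idp : ∀ k, IdentDistrib (fun ω => p (ξ k ω)) (fun ω => p (ζ ω)) P P :=
    fun k => (hident k).comp hp
  have idq : ∀ k, IdentDistrib (fun ω => q (ξ k ω)) (fun ω => q (ζ ω)) P P :=
    fun k => (hident k).comp hq
  have hpm : ∀ k, AEMeasurable (fun ω => p (ξ k ω)) P := fun k => hp.comp_aemeasurable (hξm k)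
  have hqL' : ∀ k, MemLp (fun ω => q (ξ k ω)) 2 P := fun k => (idq k).memLp_iff.2 hqL
  refine ⟨16 * (2 * R) ^ 4,
    fun n ω => partialSups (fun k => |∑ j ∈ Finset.range k, q (ξ j ω)|) n,
    fun n ω => partialSups (fun k => |∑ j ∈ Finset.range k, p (ξ j ω)|) n,
    fun n ω => (abs_nonneg _).trans
      (le_partialSups (fun k => |∑ j ∈ Finset.range k, q (ξ j ω)|) n),
    fun n ω => (abs_nonneg _).trans
      (le_partialSups (fun k => |∑ j ∈ Finset.range k, p (ξ j ω)|) n),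
    fun n => memLp_partialSups (fun k => (memLp_sum_range hqL' k).abs) n, ?_, ?_, ?_, ?_⟩
  · intro n
    simp only [sq_partialSups_abs]
    exact memLp_partialSups (fun k => memLp_pow_sum_of_bound hpm (fun _ ω => hpb _) k 2 2) n
  · intro n ω k hk
    have h1 : ∑ j ∈ Finset.range k, ξ j ω =
        ∑ j ∈ Finset.range k, q (ξ j ω) + ∑ j ∈ Finset.range k, p (ξ j ω) := by
      rw [← Finset.sum_add_distrib]
      exact Finset.sum_congr rfl fun j _ => by simp only [q]; ring
    rw [h1]
    exact (abs_add_le _ _).trans (add_le_add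
      (le_partialSups_of_le (fun k => |∑ j ∈ Finset.range k, q (ξ j ω)|) hk)
      (le_partialSups_of_le (fun k => |∑ j ∈ Finset.range k, p (ξ j ω)|) hk))
  · intro n
    refine (integral_sq_max_abs_sum_le hindq hqL' (fun k => ?_) (s := δ / 4) (fun k => ?_)
      n).trans (by linarith)
    · rw [(idq k).integral_eq, hq0]
    · exact ((idq k).comp (measurable_id.pow_const 2)).integral_eq.trans_le hq2
  · intro n
    simp only [sq_partialSups_abs]
    exact integral_sq_max_sq_sum_le hindp hpm (fun k => by rw [(idp k).integral_eq, hp0])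
      (fun k ω => hpb _) n

end Maximal
-- Deterministic estimates along and across the drift.
-- If `B ≤ A`, then `|y| ≤ 4A` is added linearly. Otherwise `|y| ≤ 4B`, and `√(t² + 16B²) ≤ t +
-- 8B²/t` with `t ≥ a`.
theorem sqrt_sq_add_sq_le {x y t a A B : ℝ} (ha : 0 < a) (hxt : |x| ≤ t) (hat : a ≤ t)
    (hA : 0 ≤ A) (hy : |y| ≤ 2 * (A + B)) :
    Real.sqrt (x ^ 2 + y ^ 2) ≤ t + 4 * A + 8 * B ^ 2 / a := by
  have hx2 : x ^ 2 ≤ t ^ 2 := sq_le_sq' (by linarith [neg_abs_le x]) (by linarith [le_abs_self x])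
  have ht : 0 < t := ha.trans_le hat
  have hBa : 0 ≤ 8 * B ^ 2 / a := by positivity
  refine Real.sqrt_le_iff.2 ⟨by linarith, ?_⟩
  rcases le_total B A with h | h
  · have hy2 : y ^ 2 ≤ (4 * A) ^ 2 := sq_le_sq' (by linarith [neg_abs_le y])
      (by linarith [le_abs_self y])
    have : (t + 4 * A) ^ 2 ≤ (t + 4 * A + 8 * B ^ 2 / a) ^ 2 :=
      pow_le_pow_left₀ (by linarith) (by linarith) 2
    nlinarith [mul_nonneg ht.le hA]
  · have hy2 : y ^ 2 ≤ (4 * B) ^ 2 := sq_le_sq' (by linarith [neg_abs_le y])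
      (by linarith [le_abs_self y])
    have h1 : 8 * B ^ 2 ≤ t * (8 * B ^ 2 / a) := by
      calc 8 * B ^ 2 = a * (8 * B ^ 2 / a) := by field_simp
        _ ≤ t * (8 * B ^ 2 / a) := mul_le_mul_of_nonneg_right hat hBa
    have : (t + 8 * B ^ 2 / a) ^ 2 ≤ (t + 4 * A + 8 * B ^ 2 / a) ^ 2 :=
      pow_le_pow_left₀ (by linarith) (by linarith) 2
    nlinarith [sq_nonneg (8 * B ^ 2 / a)]

/-- Increments of a walk with positive drift `m` and fluctuations `U` barely exceed its final
value. -/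
theorem abs_increment_le {U : ℕ → ℝ} {m h N₁ N₂ A B : ℝ} {n : ℕ} (hm : 0 < m) (hh : 0 < h)
    (hh2 : h ≤ 1 / 2) (hn : 0 < n) (hA : 0 ≤ A) (h1 : 0 ≤ N₁) (h2 : 0 ≤ N₂)
    (hN₁ : ∀ k ≤ n, (k : ℝ) ≤ h * n → |U k| ≤ N₁)
    (hN₂ : ∀ k ≤ n, (k : ℝ) ≤ h * n → |U n - U (n - k)| ≤ N₂)
    (hAB : ∀ k ≤ n, |U k| ≤ A + B) :
    (∀ i ≤ n, ∀ j ≤ n, |(j * m + U j) - (i * m + U i)| ≤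
      n * m + U n + N₁ + N₂ + 3 * (2 * A + B ^ 2 / (h * m * n))) ∧
    m * n / 2 ≤ n * m + U n + N₁ + N₂ + 3 * (2 * A + B ^ 2 / (h * m * n)) := by
  have hn' : (0 : ℝ) < n := by exact_mod_cast hn
  have hc : 0 < h * m * n := by positivity
  set c := h * m * n with hcdef
  have hG : 2 * B - c ≤ B ^ 2 / c := by
    rw [le_div_iff₀ hc]; nlinarith [sq_nonneg (B - c)]
  have hG0 : 0 ≤ B ^ 2 / c := by positivity
  -- Before time `hn` the bound is `N₁`; afterwards the drift has gained `c`, which is set against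
  -- the fluctuation through `hG`.
  have lo : ∀ k ≤ n, -(k * m + U k) ≤ N₁ + (2 * A + B ^ 2 / c) := fun k hk => by
    have hkm : 0 ≤ k * m := by positivity
    rcases le_total (k : ℝ) (h * n) with hl | hl
    · linarith [hN₁ k hk hl, neg_le_abs (U k)]
    · have : c ≤ k * m := by rw [hcdef]; nlinarith
      linarith [hAB k hk, neg_le_abs (U k)]
  -- The same argument run backwards from time `n`, with `l = n - k`.
  have hi : ∀ k ≤ n, k * m + U k ≤ n * m + U n + N₂ + (2 * A + B ^ 2 / c) := fun k hk => by
    obtain ⟨l, rfl⟩ := Nat.exists_eq_add_of_le hk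
    have hlm : 0 ≤ l * m := by positivity
    push_cast at *
    rcases le_total (l : ℝ) (h * (k + l)) with hl | hl
    · have := hN₂ l (by lia) hl
      rw [Nat.add_sub_cancel] at this
      linarith [neg_le_abs (U (k + l) - U k)]
    · have : c ≤ l * m := by rw [hcdef]; nlinarith
      linarith [hAB k hk, le_abs_self (U k), hAB (k + l) le_rfl, neg_le_abs (U (k + l))]
  refine ⟨fun i hin j hjn => abs_le.2 ⟨?_, ?_⟩, ?_⟩
  · linarith [lo j hjn, hi i hin]
  · linarith [lo i hin, hi j hjn]
  · have : c ≤ m * n / 2 := by rw [hcdef]; nlinarith [mul_pos hm hn']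
    linarith [hAB n le_rfl, neg_le_abs (U n)]

/-- The direction orthogonal to `e`. -/
noncomputable def perp (e : Plane) : Plane := !₂[-e 1, e 0]

theorem norm_eq_sqrt_inner {e : Plane} (he : ‖e‖ = 1) (w : Plane) :
    ‖w‖ = Real.sqrt (inner ℝ w e ^ 2 + inner ℝ w (perp e) ^ 2) := by
  have he2 : e 0 ^ 2 + e 1 ^ 2 = 1 := by
    have := EuclideanSpace.norm_sq_eq e
    rw [he] at this
    simpa [Fin.sum_univ_two] using this.symm
  rw [EuclideanSpace.norm_eq]
  congr 1
  simp only [PiLp.inner_apply, Fin.sum_univ_two, perp, Real.norm_eq_abs, sq_abs]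
  simp
  linear_combination (-(w 0 ^ 2 + w 1 ^ 2)) * he2

theorem inner_perp_self (e : Plane) : inner ℝ e (perp e) = 0 := by
  simp [PiLp.inner_apply, Fin.sum_univ_two, perp]
  ring

/-! ### The diameter as a finite maximum. -/

section Diameter

variable {Ω : Type*} (X : ℕ → Ω → Plane)

theorem norm_walk_sub_le_diameter {n i j : ℕ} (hi : i ≤ n) (hj : j ≤ n) (ω : Ω) :
    ‖walk X j ω - walk X i ω‖ ≤ diameter X n ω := by
  rw [← dist_eq_norm]
  exact Metric.dist_le_diam_of_mem (((Set.finite_Iic n).image _).isBounded)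
    (Set.mem_image_of_mem _ hj) (Set.mem_image_of_mem _ hi)

theorem diameter_le {n : ℕ} {ω : Ω} {c : ℝ}
    (h : ∀ i ≤ n, ∀ j ≤ n, ‖walk X j ω - walk X i ω‖ ≤ c) : diameter X n ω ≤ c := by
  refine Metric.diam_le_of_forall_dist_le ((norm_nonneg _).trans (h 0 n.zero_le 0 n.zero_le)) ?_
  rintro _ ⟨j, hj, rfl⟩ _ ⟨i, hi, rfl⟩
  rw [dist_eq_norm]
  exact h i hi j hj

theorem diameter_eq_partialSups (n : ℕ) (ω : Ω) :
    diameter X n ω =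
      partialSups (fun i => partialSups (fun j => ‖walk X j ω - walk X i ω‖) n) n := by
  refine le_antisymm (diameter_le X fun i hi j hj => ?_)
    (partialSups_le _ _ _ fun i hi => partialSups_le _ _ _ fun j hj =>
      norm_walk_sub_le_diameter X hi hj ω)
  exact (le_partialSups_of_le (fun j => ‖walk X j ω - walk X i ω‖) hj).trans
    (le_partialSups_of_le (fun i => partialSups (fun j => ‖walk X j ω - walk X i ω‖) n) hi)

theorem walk_zero (ω : Ω) : walk X 0 ω = 0 := by simp [walk]

theorem inner_walk_le_diameter {e : Plane} (he : ‖e‖ = 1) (n : ℕ) (ω : Ω) :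
    inner ℝ (walk X n ω) e ≤ diameter X n ω := by
  have h1 := real_inner_le_norm (walk X n ω) e
  have h2 := norm_walk_sub_le_diameter X n.zero_le le_rfl ω
  rw [walk_zero, sub_zero] at h2
  rw [he, mul_one] at h1
  exact h1.trans h2

variable [MeasurableSpace Ω] {P : Measure Ω} {X}

theorem memLp_walk {p : ENNReal} (hX : ∀ k, MemLp (X k) p P) (n : ℕ) : MemLp (walk X n) p P :=
  memLp_finsetSum _ fun k _ => hX k

theorem memLp_diameter {p : ENNReal} (hX : ∀ k, MemLp (X k) p P) (n : ℕ) :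
    MemLp (diameter X n) p P := by
  have : diameter X n = fun ω =>
      partialSups (fun i => partialSups (fun j => ‖walk X j ω - walk X i ω‖) n) n :=
    funext fun ω => diameter_eq_partialSups X n ω
  rw [this]
  exact memLp_partialSups (fun i => memLp_partialSups
    (fun j => ((memLp_walk hX j).sub (memLp_walk hX i)).norm) n) n

end Diameter
-- Time reversal and the `L²` bound on the excess.
-- Reversing the first `n` steps turns the last `k` steps into a partial sum, so Doob's inequality
-- also controls the walk near time `n`. Indices from `n` on stay fixed to keep the reindexing
-- injective on `ℕ`, hence independence.
theorem sum_reflect_eq_sub (f : ℕ → ℝ) {n k : ℕ} (hk : k ≤ n) :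
    ∑ j ∈ Finset.range k, f (if j < n then n - 1 - j else j) =
      ∑ j ∈ Finset.range n, f j - ∑ j ∈ Finset.range (n - k), f j := by
  induction k with
  | zero => simp
  | succ k ih =>
    obtain ⟨l, rfl⟩ := Nat.exists_eq_add_of_le hk
    rw [Finset.sum_range_succ, ih (by lia), if_pos (by lia),
      show k + 1 + l - k = l + 1 by lia, show k + 1 + l - (k + 1) = l by lia,
      show k + 1 + l - 1 - k = l by lia, Finset.sum_range_succ _ l]
    ring

theorem reflect_injective (n : ℕ) :
    Function.Injective fun j : ℕ => if j < n then n - 1 - j else j := by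
  intro a b h
  simp only at h
  split_ifs at h <;> lia

variable {Ω : Type*} [MeasurableSpace Ω] {P : Measure Ω} [IsProbabilityMeasure P]

/-- The excess of the range of a planar walk over its displacement in the direction of the drift
is negligible in `L²` at the scale `√n`. -/
theorem tendsto_integral_sq_excess {ξ η : ℕ → Ω → ℝ} {ζ₁ ζ₂ : Ω → ℝ}
    (hξ : iIndepFun ξ P) (hη : iIndepFun η P)
    (hξid : ∀ k, IdentDistrib (ξ k) ζ₁ P P) (hηid : ∀ k, IdentDistrib (η k) ζ₂ P P)
    (h1 : MemLp ζ₁ 2 P) (h2 : MemLp ζ₂ 2 P) (h10 : ∫ ω, ζ₁ ω ∂P = 0) (h20 : ∫ ω, ζ₂ ω ∂P = 0)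
    {m : ℝ} (hm : 0 < m) {T : ℕ → Ω → ℝ} (hT0 : ∀ n ω, 0 ≤ T n ω)
    (hT : ∀ n ω t, (∀ i ≤ n, ∀ j ≤ n,
      Real.sqrt (((j * m + ∑ k ∈ Finset.range j, ξ k ω) -
          (i * m + ∑ k ∈ Finset.range i, ξ k ω)) ^ 2 +
        (∑ k ∈ Finset.range j, η k ω - ∑ k ∈ Finset.range i, η k ω) ^ 2) ≤
        n * m + ∑ k ∈ Finset.range n, ξ k ω + t) → T n ω ≤ t) :
    Tendsto (fun n : ℕ => (n : ℝ)⁻¹ * ∫ ω, T n ω ^ 2 ∂P) atTop (𝓝 0) := by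
  set s := ∫ ω, ζ₁ ω ^ 2 ∂P with hs
  have hs0 : 0 ≤ s := integral_nonneg fun ω => sq_nonneg _
  have hξL : ∀ k, MemLp (ξ k) 2 P := fun k => (hξid k).memLp_iff.2 h1
  have hξ0 : ∀ k, ∫ ω, ξ k ω ∂P = 0 := fun k => (hξid k).integral_eq.trans h10
  have hξs : ∀ k, ∫ ω, ξ k ω ^ 2 ∂P ≤ s := fun k =>
    ((hξid k).comp (measurable_id.pow_const 2)).integral_eq.le
  have key : ∀ ε > 0, ∃ K : ℝ, ∀ n : ℕ, 0 < n → ∫ ω, T n ω ^ 2 ∂P ≤ ε * n + K := by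
    intro ε hε
    -- `624 = 2 (216 + 96)`: the `A` and `A'` terms of `hsq` together contribute at most `εn/2`.
    obtain ⟨C, A, B, hA0, -, hAL, hBL, hAB, hA2, hB4⟩ :=
      exists_max_decomposition hξ hξid h1 h10 (δ := ε / 624) (by positivity)
    obtain ⟨C', A', B', hA0', -, hAL', hBL', hAB', hA2', hB4'⟩ :=
      exists_max_decomposition hη hηid h2 h20 (δ := ε / 624) (by positivity)
    -- `48 = 2 · 6 · 4`: the two end pieces contribute the other `εn/2`.
    obtain ⟨h, hh, hh2, hhs⟩ : ∃ h : ℝ, 0 < h ∧ h ≤ 1 / 2 ∧ 48 * h * s ≤ ε / 2 := by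
      refine ⟨min (1 / 2) (ε / (96 * (s + 1))), by positivity, min_le_left _ _, ?_⟩
      have : min (1 / 2) (ε / (96 * (s + 1))) * (96 * (s + 1)) ≤ ε :=
        (le_div_iff₀ (by positivity)).1 (min_le_right _ _)
      have h0 : 0 ≤ min (1 / 2) (ε / (96 * (s + 1))) := by positivity
      nlinarith
    -- The `B` terms carry `n⁻²` against fourth moments of order `n²`, so they stay bounded.
    refine ⟨54 * C / (h * m) ^ 2 + 1536 * C' / m ^ 2, fun n hn => ?_⟩
    have hn' : (0 : ℝ) < n := by exact_mod_cast hn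
    let N := ⌊h * n⌋₊
    have hN : (N : ℝ) ≤ h * n := Nat.floor_le (by positivity)
    let σ : ℕ → ℕ := fun j => if j < n then n - 1 - j else j
    let N₁ : Ω → ℝ := fun ω => partialSups (fun k => |∑ j ∈ Finset.range k, ξ j ω|) N
    let N₂ : Ω → ℝ := fun ω => partialSups (fun k => |∑ j ∈ Finset.range k, ξ (σ j) ω|) N
    have hN₁L : MemLp N₁ 2 P := memLp_partialSups (fun k => (memLp_sum_range hξL k).abs) N
    have hN₂L : MemLp N₂ 2 P :=
      memLp_partialSups (fun k => (memLp_sum_range (fun j => hξL (σ j)) k).abs) N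
    have hN₁0 : ∀ ω, 0 ≤ N₁ ω := fun ω =>
      (abs_nonneg _).trans (le_partialSups (fun k => |∑ j ∈ Finset.range k, ξ j ω|) N)
    have hN₂0 : ∀ ω, 0 ≤ N₂ ω := fun ω =>
      (abs_nonneg _).trans (le_partialSups (fun k => |∑ j ∈ Finset.range k, ξ (σ j) ω|) N)
    have hN₁i : ∫ ω, N₁ ω ^ 2 ∂P ≤ 4 * (h * n * s) :=
      (integral_sq_max_abs_sum_le hξ hξL hξ0 hξs N).trans (by gcongr)
    have hN₂i : ∫ ω, N₂ ω ^ 2 ∂P ≤ 4 * (h * n * s) :=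
      (integral_sq_max_abs_sum_le (hξ.precomp (reflect_injective n)) (fun k => hξL (σ k))
        (fun k => hξ0 (σ k)) (fun k => hξs (σ k)) N).trans (by gcongr)
    have hTle : ∀ ω, T n ω ≤ N₁ ω + N₂ ω + 3 * (2 * A n ω + B n ω ^ 2 / (h * m * n)) +
        4 * A' n ω + 8 * B' n ω ^ 2 / (m * n / 2) := by
      intro ω
      obtain ⟨hinc, hlow⟩ := abs_increment_le (U := fun k => ∑ j ∈ Finset.range k, ξ j ω)
        hm hh hh2 hn (hA0 n ω) (hN₁0 ω) (hN₂0 ω)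
        (fun k _ hk => le_partialSups_of_le (fun k => |∑ j ∈ Finset.range k, ξ j ω|)
          (Nat.le_floor hk))
        (fun k hkn hk => by
          rw [← sum_reflect_eq_sub (fun j => ξ j ω) hkn]
          exact le_partialSups_of_le (fun k => |∑ j ∈ Finset.range k, ξ (σ j) ω|)
            (Nat.le_floor hk)) (hAB n ω)
      refine hT n ω _ fun i hi j hj => ?_
      have hV : |∑ k ∈ Finset.range j, η k ω - ∑ k ∈ Finset.range i, η k ω| ≤
          2 * (A' n ω + B' n ω) :=
        (abs_sub _ _).trans (by linarith [hAB' n ω i hi, hAB' n ω j hj])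
      refine (sqrt_sq_add_sq_le (by positivity) (hinc i hi j hj) hlow (hA0' n ω) hV).trans ?_
      linarith
    have hB2 : Integrable (fun ω => (B n ω ^ 2) ^ 2) P := (hBL n).integrable_sq
    have hB2' : Integrable (fun ω => (B' n ω ^ 2) ^ 2) P := (hBL' n).integrable_sq
    have hsq : ∀ ω, T n ω ^ 2 ≤ 6 * N₁ ω ^ 2 + 6 * N₂ ω ^ 2 + 216 * A n ω ^ 2 +
        54 / (h * m * n) ^ 2 * (B n ω ^ 2) ^ 2 + 96 * A' n ω ^ 2 +
        1536 / (m * n) ^ 2 * (B' n ω ^ 2) ^ 2 := by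
      intro ω
      have hp := pow_le_pow_left₀ (hT0 n ω) (hTle ω) 2
      have e1 : 54 / (h * m * n) ^ 2 * (B n ω ^ 2) ^ 2 =
          54 * (B n ω ^ 2 / (h * m * n)) ^ 2 := by ring
      have e2 : 1536 / (m * n) ^ 2 * (B' n ω ^ 2) ^ 2 =
          6 * (8 * B' n ω ^ 2 / (m * n / 2)) ^ 2 := by field_simp; ring
      rw [e1, e2]
      set b := B n ω ^ 2 / (h * m * n)
      set b' := 8 * B' n ω ^ 2 / (m * n / 2)
      -- Cauchy–Schwarz for six summands; this is the factor `6` in the coefficients of `hsq`.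
      have := sq_sum_le_card_mul_sum_sq (s := Finset.univ)
        (f := ![N₁ ω, N₂ ω, 6 * A n ω, 3 * b, 4 * A' n ω, b'])
      simp [Fin.sum_univ_succ] at this
      have e3 : N₁ ω + N₂ ω + 3 * (2 * A n ω + b) + 4 * A' n ω + b' =
        N₁ ω + (N₂ ω + (6 * A n ω + (3 * b + (4 * A' n ω + b')))) := by ring
      rw [e3] at hp
      linarith
    have i1 : Integrable (fun ω => 6 * N₁ ω ^ 2) P := hN₁L.integrable_sq.const_mul 6
    have i2 : Integrable (fun ω => 6 * N₂ ω ^ 2) P := hN₂L.integrable_sq.const_mul 6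
    have i3 : Integrable (fun ω => 216 * A n ω ^ 2) P := (hAL n).integrable_sq.const_mul _
    have i4 : Integrable (fun ω => 54 / (h * m * n) ^ 2 * (B n ω ^ 2) ^ 2) P := hB2.const_mul _
    have i5 : Integrable (fun ω => 96 * A' n ω ^ 2) P := (hAL' n).integrable_sq.const_mul _
    have i6 : Integrable (fun ω => 1536 / (m * n) ^ 2 * (B' n ω ^ 2) ^ 2) P := hB2'.const_mul _
    refine (integral_mono_of_nonneg (ae_of_all _ fun ω => sq_nonneg _)
      (((((i1.add i2).add i3).add i4).add i5).add i6) (ae_of_all _ hsq)).trans ?_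
    rw [integral_add' ((((i1.add i2).add i3).add i4).add i5) i6,
      integral_add' (((i1.add i2).add i3).add i4) i5, integral_add' ((i1.add i2).add i3) i4,
      integral_add' (i1.add i2) i3, integral_add' i1 i2]
    simp only [integral_const_mul]
    have b4 : 54 / (h * m * n) ^ 2 * ∫ ω, (B n ω ^ 2) ^ 2 ∂P ≤ 54 * C / (h * m) ^ 2 := by
      refine (mul_le_mul_of_nonneg_left (hB4 n) (by positivity)).trans_eq ?_
      field_simp
    have b6 : 1536 / (m * n) ^ 2 * ∫ ω, (B' n ω ^ 2) ^ 2 ∂P ≤ 1536 * C' / m ^ 2 := by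
      refine (mul_le_mul_of_nonneg_left (hB4' n) (by positivity)).trans_eq ?_
      field_simp
    nlinarith [hA2 n, hA2' n, mul_le_mul_of_nonneg_right hhs hn'.le]
  rw [Metric.tendsto_atTop]
  intro ε hε
  obtain ⟨K, hK⟩ := key (ε / 2) (by positivity)
  obtain ⟨M, hM⟩ := exists_nat_gt (K / (ε / 2))
  refine ⟨M + 1, fun n hn => ?_⟩
  have hn' : (0 : ℝ) < n := by exact_mod_cast (show 0 < n by lia)
  have hMn : (M : ℝ) ≤ n := by exact_mod_cast (show M ≤ n by lia)
  rw [dist_zero_right, Real.norm_of_nonneg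
    (mul_nonneg (inv_nonneg.2 hn'.le) (integral_nonneg fun ω => sq_nonneg _)),
    inv_mul_lt_iff₀ hn']
  have h3 := (div_lt_iff₀ (by positivity)).1 hM
  nlinarith [hK n (by lia)]

/-! ### Transfer of variance and of limits in distribution. -/

section Limits

variable {Ω : Type*} [MeasurableSpace Ω] {P : Measure Ω} [IsProbabilityMeasure P]

/-- The variance of `X + tY` is a nonnegative quadratic in `t`, so its discriminant is nonpositive.
-/
theorem sq_covariance_le {X Y : Ω → ℝ} (hX : MemLp X 2 P) (hY : MemLp Y 2 P) :
    cov[X, Y; P] ^ 2 ≤ Var[X; P] * Var[Y; P] := by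
  have h : ∀ t : ℝ, 0 ≤ Var[Y; P] * (t * t) + 2 * cov[X, Y; P] * t + Var[X; P] := fun t => by
    have := variance_nonneg (X + t • Y) P
    rw [variance_add hX (hY.const_smul t), variance_smul, covariance_smul_right] at this
    linarith
  have := discrim_le_zero h
  rw [discrim] at this
  linarith

/-- A perturbation that is negligible in `L²` does not change the asymptotic variance. -/
theorem tendsto_inv_mul_variance_add {W T : ℕ → Ω → ℝ} (hW : ∀ n, MemLp (W n) 2 P)
    (hT : ∀ n, MemLp (T n) 2 P) {v : ℝ}
    (hWv : Tendsto (fun n : ℕ => (n : ℝ)⁻¹ * Var[W n; P]) atTop (𝓝 v))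
    (hT0 : Tendsto (fun n : ℕ => (n : ℝ)⁻¹ * ∫ ω, T n ω ^ 2 ∂P) atTop (𝓝 0)) :
    Tendsto (fun n : ℕ => (n : ℝ)⁻¹ * Var[fun ω => W n ω + T n ω; P]) atTop (𝓝 v) := by
  have hTv : Tendsto (fun n : ℕ => (n : ℝ)⁻¹ * Var[T n; P]) atTop (𝓝 0) :=
    squeeze_zero (fun n => mul_nonneg (by positivity) (variance_nonneg _ _))
      (fun n => mul_le_mul_of_nonneg_left
        (variance_le_expectation_sq (hT n).aestronglyMeasurable) (by positivity)) hT0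
  have hcov : Tendsto (fun n : ℕ => (n : ℝ)⁻¹ * cov[W n, T n; P]) atTop (𝓝 0) := by
    refine squeeze_zero_norm (a := fun n : ℕ =>
      Real.sqrt (((n : ℝ)⁻¹ * Var[W n; P]) * ((n : ℝ)⁻¹ * Var[T n; P]))) (fun n => ?_) ?_
    · refine Real.le_sqrt_of_sq_le ?_
      rw [Real.norm_eq_abs, sq_abs]
      nlinarith [mul_le_mul_of_nonneg_left (sq_covariance_le (hW n) (hT n))
        (sq_nonneg ((n : ℝ)⁻¹))]
    · simpa using (hWv.mul hTv).sqrt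
  have := (hWv.add (hcov.const_mul 2)).add hTv
  simp only [mul_zero, add_zero] at this
  refine this.congr fun n => ?_
  rw [variance_fun_add (hW n) (hT n)]
  ring

/-- Since `(E T)² ≤ E T²`. It gives both the asymptotics of the mean and, for `T ≥ 0`, convergence
in `L¹`. -/
theorem tendsto_integral_div_sqrt {T : ℕ → Ω → ℝ} (hT : ∀ n, MemLp (T n) 2 P)
    (hT0 : Tendsto (fun n : ℕ => (n : ℝ)⁻¹ * ∫ ω, T n ω ^ 2 ∂P) atTop (𝓝 0)) {v : ℝ}
    (hv : 0 < v) :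
    Tendsto (fun n : ℕ => (∫ ω, T n ω ∂P) / Real.sqrt (n * v)) atTop (𝓝 0) := by
  refine squeeze_zero_norm (a := fun n : ℕ =>
    Real.sqrt (v⁻¹ * ((n : ℝ)⁻¹ * ∫ ω, T n ω ^ 2 ∂P))) (fun n => ?_) ?_
  · refine Real.le_sqrt_of_sq_le ?_
    have h := variance_nonneg (T n) P
    rw [variance_eq_sub (hT n)] at h
    simp only [Pi.pow_apply] at h
    rw [Real.norm_eq_abs, sq_abs, div_pow, Real.sq_sqrt (by positivity), div_eq_inv_mul, mul_inv,
      mul_comm (n : ℝ)⁻¹, mul_assoc]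
    gcongr
    linarith
  · simpa using (hT0.const_mul v⁻¹).sqrt

theorem tendstoInMeasure_div_sqrt {T : ℕ → Ω → ℝ} (hT : ∀ n, MemLp (T n) 2 P)
    (hnn : ∀ n ω, 0 ≤ T n ω)
    (hT0 : Tendsto (fun n : ℕ => (n : ℝ)⁻¹ * ∫ ω, T n ω ^ 2 ∂P) atTop (𝓝 0)) {v : ℝ}
    (hv : 0 < v) :
    TendstoInMeasure P (fun (n : ℕ) ω => T n ω / Real.sqrt (n * v)) atTop 0 := by
  refine tendstoInMeasure_of_tendsto_eLpNorm_of_ne_top one_ne_zero ENNReal.one_ne_top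
    (fun n => ((hT n).aestronglyMeasurable.aemeasurable.div_const _).aestronglyMeasurable) aestronglyMeasurable_zero ?_
  have h := (ENNReal.continuous_ofReal.tendsto _).comp (tendsto_integral_div_sqrt hT hT0 hv)
  rw [ENNReal.ofReal_zero] at h
  refine h.congr fun n => ?_
  rw [sub_zero, eLpNorm_one_eq_lintegral_enorm, Function.comp, ← integral_div,
    ← ofReal_integral_norm_eq_lintegral_enorm (((hT n).integrable one_le_two).div_const _)]
  simp_rw [Real.norm_of_nonneg (div_nonneg (hnn n _) (Real.sqrt_nonneg _))]

theorem tendstoInMeasure_const {E : Type*} [NormedAddCommGroup E] {c : ℕ → E} {a : E}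
    (h : Tendsto c atTop (𝓝 a)) :
    TendstoInMeasure P (fun n (_ : Ω) => c n) atTop fun _ => a :=
  tendstoInMeasure_of_tendsto_ae (fun _ => aestronglyMeasurable_const) (ae_of_all _ fun _ => h)

/-- Studentisation: the deterministic centring `n m` and scaling `√(n v)` may be replaced by the
exact mean and standard deviation. -/
theorem tendstoInDistribution_standardize {Ω' : Type*} [MeasurableSpace Ω'] {P' : Measure Ω'}
    [IsProbabilityMeasure P'] {ζ : Ω' → ℝ} {D : ℕ → Ω → ℝ} {m v : ℝ} (hv : 0 < v)
    (hD0 : ∀ ω, D 0 ω = 0)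
    (hmean : Tendsto (fun n : ℕ => (∫ ω, D n ω ∂P - n * m) / Real.sqrt (n * v)) atTop (𝓝 0))
    (hvar : Tendsto (fun n : ℕ => (n : ℝ)⁻¹ * Var[D n; P]) atTop (𝓝 v))
    (h : TendstoInDistribution (fun (n : ℕ) ω => (D n ω - n * m) / Real.sqrt (n * v)) atTop ζ
      (fun _ => P) P') :
    TendstoInDistribution (fun (n : ℕ) ω => (D n ω - ∫ ω', D n ω' ∂P) / Real.sqrt (Var[D n; P]))
      atTop ζ (fun _ => P) P' := by
  have hc : Tendsto (fun n : ℕ => Real.sqrt (n * v) / Real.sqrt (Var[D n; P])) atTop (𝓝 1) := by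
    have h1 : Tendsto (fun n : ℕ => Real.sqrt (v / ((n : ℝ)⁻¹ * Var[D n; P]))) atTop
        (𝓝 (Real.sqrt (v / v))) := (tendsto_const_nhds.div hvar hv.ne').sqrt
    rw [div_self hv.ne', Real.sqrt_one] at h1
    refine h1.congr' ?_
    filter_upwards [eventually_gt_atTop 0] with n hn
    have hn' : (0 : ℝ) < n := by exact_mod_cast hn
    rw [← Real.sqrt_div (by positivity)]
    congr 1
    rw [← div_div, div_inv_eq_mul, mul_comm]
  -- Slutsky's theorem with two deterministic sequences: the ratio of scales tends to `1`, the shift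
  -- of centre to `0`.
  have hlim := h.continuous_comp_prodMk_of_tendstoInMeasure_const
    (g := fun z : ℝ × (ℝ × ℝ) => z.2.1 * (z.1 - z.2.2)) (by fun_prop)
    (tendstoInMeasure_const (P := P) (hc.prodMk_nhds hmean)) (fun _ => aemeasurable_const)
  simp only [sub_zero, one_mul] at hlim
  refine hlim.congr (fun n => ae_of_all _ fun ω => ?_) (ae_of_all _ fun _ => rfl)
  rcases Nat.eq_zero_or_pos n with rfl | hn
  -- At `n = 0` the scale `√(n v)` vanishes and cannot be cancelled; both sides are `0` because `D 0
  -- = 0`.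
  · simp [hD0]
  · have hn' : (0 : ℝ) < n := by exact_mod_cast hn
    have : Real.sqrt (n * v) ≠ 0 := (Real.sqrt_pos.2 (by positivity)).ne'
    simp only
    field_simp
    ring

end Limits

/-! ### The main theorem. -/

theorem diameter_zero {Ω : Type*} (X : ℕ → Ω → Plane) (ω : Ω) : diameter X 0 ω = 0 := by
  simp [diameter_eq_partialSups]

/-- The free centring `m` serves both coordinates: `‖μ‖` along the drift and `0` across it. -/
theorem inner_walk {Ω : Type*} (X : ℕ → Ω → Plane) (e : Plane) (m : ℝ) (n : ℕ) (ω : Ω) :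
    inner ℝ (walk X n ω) e = n * m + ∑ k ∈ Finset.range n, (inner ℝ (X k ω) e - m) := by
  rw [walk, sum_inner, Finset.sum_sub_distrib]
  simp

end PlanarWalk

open PlanarWalk in
theorem mainTheorem11 {Ω : Type*} [MeasurableSpace Ω] (P : Measure Ω) [IsProbabilityMeasure P]
    (Z : Ω → PlanarWalk.Plane) (X : ℕ → Ω → PlanarWalk.Plane)
    (hindep : iIndepFun X P) (hident : ∀ k, IdentDistrib (X k) Z P P)
    (hmom : MemLp Z 2 P) (hdrift : PlanarWalk.drift P Z ≠ 0) :
    (∀ n : ℕ, MemLp (PlanarWalk.diameter X n) 2 P) ∧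
    Tendsto (fun n : ℕ => (n : ℝ)⁻¹ * Var[PlanarWalk.diameter X n; P]) atTop
      (𝓝 (PlanarWalk.sigmaParSq P Z)) ∧
    (0 < PlanarWalk.sigmaParSq P Z →
      ∀ {Ω' : Type*} [MeasurableSpace Ω'] (P' : Measure Ω') [IsProbabilityMeasure P']
        (ζ : Ω' → ℝ), HasLaw ζ (gaussianReal 0 1) P' →
        TendstoInDistribution
          (fun (n : ℕ) (ω : Ω) =>
            (PlanarWalk.diameter X n ω - ∫ ω', PlanarWalk.diameter X n ω' ∂P) /
              Real.sqrt (Var[PlanarWalk.diameter X n; P]))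
          atTop ζ (fun _ => P) P' ∧
        TendstoInDistribution
          (fun (n : ℕ) (ω : Ω) =>
            (PlanarWalk.diameter X n ω - (n : ℝ) * ‖PlanarWalk.drift P Z‖) /
              Real.sqrt ((n : ℝ) * PlanarWalk.sigmaParSq P Z))
          atTop ζ (fun _ => P) P') := by
  have hXL : ∀ k, MemLp (X k) 2 P := fun k => (hident k).memLp_iff.2 hmom
  have hDL : ∀ n, MemLp (diameter X n) 2 P := memLp_diameter hXL
  set μ := drift P Z with hμ
  set m := ‖μ‖ with hmdef
  have hm : 0 < m := norm_pos_iff.2 hdrift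
  set e : Plane := m⁻¹ • μ with he
  have he1 : ‖e‖ = 1 := norm_smul_inv_norm hdrift
  have hμe : inner ℝ μ e = m := by
    rw [he, real_inner_smul_right, real_inner_self_eq_norm_sq, ← hmdef]
    field_simp
  have hμf : inner ℝ μ (perp e) = 0 := by
    have h1 : μ = m • e := by rw [he, smul_smul, mul_inv_cancel₀ hm.ne', one_smul]
    rw [h1, real_inner_smul_left, inner_perp_self, mul_zero]
  have hint : ∀ w : Plane, ∫ ω, inner ℝ (Z ω) w ∂P = inner ℝ μ w := fun w => by
    simp_rw [real_inner_comm w]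
    rw [integral_inner (hmom.integrable one_le_two)]
    rfl
  have hmeas1 : Measurable fun z : Plane => inner ℝ z e - m := by fun_prop
  have hmeas2 : Measurable fun z : Plane => inner ℝ z (perp e) - 0 := by fun_prop
  set g : Plane → ℝ := fun z => inner ℝ z e - m with hg
  have hgL : MemLp (fun ω => g (Z ω)) 2 P := (hmom.inner_const e).sub (memLp_const m)
  have hg0 : ∫ ω, g (Z ω) ∂P = 0 := by
    simp only [hg]
    rw [integral_sub ((hmom.inner_const e).integrable one_le_two) (integrable_const _), hint, hμe]
    simp
  have hσ : sigmaParSq P Z = ∫ ω, g (Z ω) ^ 2 ∂P := by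
    simp only [sigmaParSq, ← hμ, ← hmdef, ← he, inner_sub_left, hμe, hg]
  have hgind : iIndepFun (fun k ω => g (X k ω)) P := hindep.comp (fun _ => g) fun _ => hmeas1
  have hgid : ∀ k, IdentDistrib (fun ω => g (X k ω)) (fun ω => g (Z ω)) P P := fun k =>
    (hident k).comp hmeas1
  have hgXL : ∀ k, MemLp (fun ω => g (X k ω)) 2 P := fun k => (hgid k).memLp_iff.2 hgL
  set T : ℕ → Ω → ℝ := fun n ω => diameter X n ω - inner ℝ (walk X n ω) e with hTdef
  have hWL : ∀ n, MemLp (fun ω => inner ℝ (walk X n ω) e) 2 P := fun n =>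
    (memLp_walk hXL n).inner_const e
  have hTL : ∀ n, MemLp (T n) 2 P := fun n => (hDL n).sub (hWL n)
  have hTnn : ∀ n ω, 0 ≤ T n ω := fun n ω => sub_nonneg.2 (inner_walk_le_diameter X he1 n ω)
  have hT0 : Tendsto (fun n : ℕ => (n : ℝ)⁻¹ * ∫ ω, T n ω ^ 2 ∂P) atTop (𝓝 0) := by
    refine tendsto_integral_sq_excess hgind (hindep.comp (fun _ => _) fun _ => hmeas2) hgid
      (fun k => (hident k).comp hmeas2) hgL ((hmom.inner_const (perp e)).sub (memLp_const 0))
      hg0 ?_ hm hTnn fun n ω t h => ?_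
    · simp [hint, hμf]
    · rw [hTdef, sub_le_iff_le_add', inner_walk X e m]
      refine diameter_le X fun i hi j hj => le_of_eq_of_le ?_ (h i hi j hj)
      rw [norm_eq_sqrt_inner he1, inner_sub_left, inner_sub_left, inner_walk X e m,
        inner_walk X e m, inner_walk X (perp e) 0, inner_walk X (perp e) 0]
      simp [hg]
  have hDWT : ∀ n, diameter X n = fun ω => inner ℝ (walk X n ω) e + T n ω := fun n => by
    funext ω; simp [hTdef]
  have hWv : ∀ n : ℕ, Var[fun ω => inner ℝ (walk X n ω) e; P] = n * sigmaParSq P Z := fun n => by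
    simp_rw [inner_walk X e m]
    rw [variance_const_add (memLp_sum_range hgXL n).aestronglyMeasurable]
    have := IndepFun.variance_sum (s := Finset.range n) (fun k _ => hgXL k)
      fun i _ j _ hij => hgind.indepFun hij
    rw [show (fun ω => ∑ k ∈ Finset.range n, (inner ℝ (X k ω) e - m)) =
      ∑ k ∈ Finset.range n, fun ω => g (X k ω) by ext ω; simp [hg], this]
    simp_rw [(hgid _).variance_eq]
    rw [variance_of_integral_eq_zero hgL.aestronglyMeasurable.aemeasurable hg0, ← hσ]
    simp
  have hvar : Tendsto (fun n : ℕ => (n : ℝ)⁻¹ * Var[diameter X n; P]) atTop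
      (𝓝 (sigmaParSq P Z)) := by
    simp_rw [hDWT]
    refine tendsto_inv_mul_variance_add hWL hTL (tendsto_const_nhds.congr' ?_) hT0
    filter_upwards [eventually_gt_atTop 0] with n hn
    have : (n : ℝ) ≠ 0 := by exact_mod_cast hn.ne'
    rw [hWv, inv_mul_cancel_left₀ this]
  refine ⟨hDL, hvar, fun hpos Ω' _ P' _ ζ hζ => ?_⟩
  set v := sigmaParSq P Z with hv
  have hclt : TendstoInDistribution
      (fun (n : ℕ) ω => (inner ℝ (walk X n ω) e - n * m) / Real.sqrt (n * v)) atTop ζ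
      (fun _ => P) P' := by
    -- Steps are scaled to unit variance, as the CLT requires.
    have hn1 : Measurable fun x : ℝ => x / Real.sqrt v := by fun_prop
    have hid0 : ∀ k, IdentDistrib (fun ω => g (X k ω) / Real.sqrt v)
        (fun ω => g (Z ω) / Real.sqrt v) P P := fun k => (hgid k).comp hn1
    have := tendstoInDistribution_inv_sqrt_mul_sum
      (X := fun k ω => g (X k ω) / Real.sqrt v) hζ ?_ ?_
      (hgind.comp (fun _ x => x / Real.sqrt v) fun _ => hn1)
      (fun k => (hid0 k).trans (hid0 0).symm)
    · refine this.congr (fun n => ae_of_all _ fun ω => ?_) (ae_of_all _ fun _ => rfl)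
      simp only
      rw [inner_walk X e m, add_sub_cancel_left, ← Finset.sum_div, Real.sqrt_mul (by positivity)]
      simp only [hg]
      ring
    · rw [(hid0 0).integral_eq, integral_div, hg0, zero_div]
    · have := ((hid0 0).comp (measurable_id.pow_const 2)).integral_eq
      simp only [Function.comp_def, id, div_pow, Real.sq_sqrt hpos.le] at this
      simp only [Pi.pow_apply, div_pow, Real.sq_sqrt hpos.le]
      rw [this, integral_div, ← hσ, div_self hpos.ne']
  have hsecond : TendstoInDistribution
      (fun (n : ℕ) ω => (diameter X n ω - n * m) / Real.sqrt (n * v)) atTop ζ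
      (fun _ => P) P' := by
    refine tendstoInDistribution_of_tendstoInMeasure_sub _ ζ hclt ?_ fun n =>
      (((hDL n).aestronglyMeasurable.aemeasurable.sub_const _).div_const _)
    convert tendstoInMeasure_div_sqrt hTL hTnn hT0 hpos using 2 with n
    funext ω
    simp only [Pi.sub_apply, hTdef]
    ring
  refine ⟨tendstoInDistribution_standardize hpos (diameter_zero X) ?_ hvar hsecond, hsecond⟩
  refine (tendsto_integral_div_sqrt hTL hT0 hpos).congr fun n => ?_
  have hWi : ∫ ω, inner ℝ (walk X n ω) e ∂P = n * m := by
    simp_rw [inner_walk X e m]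
    rw [integral_add (integrable_const _) ((memLp_sum_range hgXL n).integrable one_le_two),
      integral_finsetSum _ fun k _ => (hgXL k).integrable one_le_two]
    simp only [(hgid _).integral_eq, hg0]
    simp
  congr 1
  simp only [hTdef]
  rw [integral_sub ((hDL n).integrable one_le_two) ((hWL n).integrable one_le_two), hWi]
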